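/- Let $R=\mathbb F_2+u\mathbb F_2+u^2\mathbb F_2$ with $u^3=u$, and let $R_w=\mathbb F_2+w\mathbb F_2$ with $w^2=0$. Identify $R$ with $\mathbb F_2\times R_w$ by the Chinese remainder isomorphism $a+ub+u^2c\mapsto (a,\ (a+b+c)+bw)$. For linear codes $C_2\subseteq\mathbb F_2^n$ and $C_w\subseteq R_w^n$, let $\mathrm{CRT}^{-1}(C_2,C_w)\subseteq R^n$ be the linear code of all words whose coordinatewise images lie in $C_2$ and in $C_w$. A linear code $C\subseteq R^n$ is of type $8^{k_1}4^{k_2}4^{k_3}2^{k_4}2^{k_5}$ if, as an $R$-module, $$C\cong R^{k_1}\oplus\langle u\rangle^{k_2}\oplus\langle 1+u\rangle^{k_3}\oplus\langle 1+u^2\rangle^{k_4}\oplus\langle u+u^2\rangle^{k_5}$$ (so that $|C|=2^{3k_1+2k_2+2k_3+k_4+k_5}$). The Gray map $\Phi:R^n\to\mathbb F_2^{3n}$ replaces each coordinate $a+ub+u^2c$ by $(a,a+c,b)$; the Lee weight of a word is the Hamming weight of its Gray image, and the Lee distance of two words is the Lee weight of their difference. Duals are taken with respect to $x\cdot y=\sum_i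 x_iy_i$. A quantum code with parameters $[[N,K,d]]$ is a $2^K$-dimensional subspace $Q$ of $(\mathbb C^2)^{\otimes N}$ with minimum distance $d$: it detects every Pauli error $E$ of weight less than $d$ (that is, $PEP$ is a scalar multiple of $P$, where $P$ is the orthogonal projection onto $Q$), but not every Pauli error of weight $d$. If only the first property is required, the parameters are written $[[N,K,\ge d]]$. **Theorem.** Let $C=\mathrm{CRT}^{-1}(C_2,C_w)$ be a cyclic code of odd length $n$ over $R$ of type $8^{k_1}4^{k_2}4^{k_3}2^{k_4}2^{k_5}$, and let $d_L$ be the minimum Lee distance of $C$. If $C_2^\perp\subseteq C_2$ and $C_w^\perp\subseteq C_w$, then $C^\perp\subseteq C$. Moreover, with $$K=6k_1+4(k_2+k_3)+2(k_4+k_5)-3n\ \ge 0,$$ the following hold. 1. $\Phi(C)^\perp\subseteq\Phi(C)$, and the CSS code of $\Phi(C)$, i.e. the span of the states $\sum_{y\in\Phi(C)^\perp}|x+y\rangle$ with $x\in\Phi(C)$, is a quantum code with parameters $[[3n,K,\ge d_L]]$. 2. There exists a quantum code with parameters $[[3n,K,d_L]]$. -/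

import Mathlib

namespace CyclicQuantum

open scoped DualNumber

noncomputable section

/-- The ring `F₂ + u F₂ + u² F₂` with `u³ = u`; `⟨a, b, c⟩` stands for `a + u b + u² c`. -/
@[ext]
structure R where
  a : ZMod 2
  b : ZMod 2
  c : ZMod 2

namespace R

instance : Zero R := ⟨⟨0, 0, 0⟩⟩
instance : One R := ⟨⟨1, 0, 0⟩⟩
instance : Add R := ⟨fun x y => ⟨x.a + y.a, x.b + y.b, x.c + y.c⟩⟩
instance : Neg R := ⟨fun x => ⟨-x.a, -x.b, -x.c⟩⟩
/-- Multiplication of polynomials in `u`, reduced with `u³ = u` and `u⁴ = u²`. -/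
instance : Mul R := ⟨fun x y =>
  ⟨x.a * y.a,
   x.a * y.b + x.b * y.a + x.b * y.c + x.c * y.b,
   x.a * y.c + x.b * y.b + x.c * y.a + x.c * y.c⟩⟩

@[simp] theorem zero_a : (0 : R).a = 0 := rfl
@[simp] theorem zero_b : (0 : R).b = 0 := rfl
@[simp] theorem zero_c : (0 : R).c = 0 := rfl
@[simp] theorem one_a : (1 : R).a = 1 := rfl
@[simp] theorem one_b : (1 : R).b = 0 := rfl
@[simp] theorem one_c : (1 : R).c = 0 := rfl
@[simp] theorem add_a (x y : R) : (x + y).a = x.a + y.a := rfl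
@[simp] theorem add_b (x y : R) : (x + y).b = x.b + y.b := rfl
@[simp] theorem add_c (x y : R) : (x + y).c = x.c + y.c := rfl
@[simp] theorem neg_a (x : R) : (-x).a = -x.a := rfl
@[simp] theorem neg_b (x : R) : (-x).b = -x.b := rfl
@[simp] theorem neg_c (x : R) : (-x).c = -x.c := rfl
@[simp] theorem mul_a (x y : R) : (x * y).a = x.a * y.a := rfl
@[simp] theorem mul_b (x y : R) :
    (x * y).b = x.a * y.b + x.b * y.a + x.b * y.c + x.c * y.b := rfl
@[simp] theorem mul_c (x y : R) :
    (x * y).c = x.a * y.c + x.b * y.b + x.c * y.a + x.c * y.c := rfl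

instance : CommRing R where
  add_assoc x y z := by ext <;> simp <;> ring
  zero_add x := by ext <;> simp
  add_zero x := by ext <;> simp
  add_comm x y := by ext <;> simp <;> ring
  left_distrib x y z := by ext <;> simp <;> ring
  right_distrib x y z := by ext <;> simp <;> ring
  zero_mul x := by ext <;> simp
  mul_zero x := by ext <;> simp
  mul_assoc x y z := by ext <;> simp <;> ring
  one_mul x := by ext <;> simp
  mul_one x := by ext <;> simp
  mul_comm x y := by ext <;> simp <;> ring
  neg_add_cancel x := by ext <;> exact neg_add_cancel _
  nsmul := nsmulRec
  zsmul := zsmulRec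

/-- The element `u`. -/
def u : R := ⟨0, 1, 0⟩

theorem u_pow_three : u ^ 3 = u := by
  rw [pow_succ, pow_two]; ext <;> simp [u]

/-- The Chinese remainder isomorphism `R ≃ F₂ × (F₂ + w F₂)`, `w² = 0`,
`a + u b + u² c ↦ (a, (a + b + c) + b w)`, with inverse
`(a, A + B w) ↦ a + B u + (a + A + B) u²`. The ring `F₂ + w F₂` is the ring of dual numbers. -/
def crt : R ≃+* ZMod 2 × (ZMod 2)[ε] where
  toFun x := (x.a, TrivSqZeroExt.inl (x.a + x.b + x.c) + TrivSqZeroExt.inr x.b)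
  invFun p := ⟨p.1, p.2.snd, p.1 + p.2.fst + p.2.snd⟩
  left_inv x := by
    ext
    · simp
    · simp
    · have h : ∀ a b c : ZMod 2, a + (a + b + c) + b = c := by decide
      simpa using h x.a x.b x.c
  right_inv p := by
    have h : ∀ a b c : ZMod 2, a + c + (a + b + c) = b := by decide
    ext
    · simp
    · simpa using h p.1 p.2.fst p.2.snd
    · simp
  map_mul' x y := by
    have h : ∀ a b c a' b' c' : ZMod 2,
        a * a' + (a * b' + b * a' + b * c' + c * b') + (a * c' + b * b' + c * a' + c * c')
          = (a + b + c) * (a' + b' + c') := by decide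
    have h' : ∀ a b c a' b' c' : ZMod 2,
        a * b' + b * a' + b * c' + c * b' = (a + b + c) * b' + b * (a' + b' + c') := by decide
    ext
    · simp
    · simpa using h x.a x.b x.c y.a y.b y.c
    · simpa using h' x.a x.b x.c y.a y.b y.c
  map_add' x y := by
    ext
    · simp
    · simp; ring
    · simp

/-- The Gray map on `R`: `a + u b + u² c ↦ (a, a + c, b)`. -/
def gray (x : R) : Fin 3 → ZMod 2 := ![x.a, x.a + x.c, x.b]

/-- The Lee weight of an element of `R`: the Hamming weight of its Gray image. -/
def leeWeight (x : R) : ℕ := hammingNorm x.gray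

end R

/-! ### Linear codes -/

/-- The Euclidean dual of a linear code. -/
def dualCode {S ι : Type*} [CommRing S] [Fintype ι] (C : Submodule S (ι → S)) :
    Submodule S (ι → S) where
  carrier := {x | ∀ y ∈ C, x ⬝ᵥ y = 0}
  add_mem' {x x'} hx hx' y hy := by rw [add_dotProduct, hx y hy, hx' y hy, add_zero]
  zero_mem' y _ := zero_dotProduct y
  smul_mem' r x hx y hy := by rw [smul_dotProduct, hx y hy, smul_zero]

/-- Invariance under the shift `(c₀, …, cₙ₋₁) ↦ (cₙ₋₁, c₀, …, cₙ₋₂)`. -/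
def IsCyclicCode {S : Type*} [CommRing S] {n : ℕ} (C : Submodule S (Fin n → S)) : Prop :=
  ∀ c ∈ C, (fun i => c ((finRotate n).symm i)) ∈ C

/-- The code `CRT⁻¹(C₂, C_w)` over `R`: the words whose coordinatewise residues lie in
`C₂` and in `C_w`. -/
def crtCode {n : ℕ} (C₂ : Submodule (ZMod 2) (Fin n → ZMod 2))
    (Cw : Submodule (ZMod 2)[ε] (Fin n → (ZMod 2)[ε])) : Submodule R (Fin n → R) where
  carrier := {x | (fun i => (R.crt (x i)).1) ∈ C₂ ∧ (fun i => (R.crt (x i)).2) ∈ Cw}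
  add_mem' {x y} hx hy := by
    constructor
    · simpa [Pi.add_def] using C₂.add_mem hx.1 hy.1
    · simpa [Pi.add_def] using Cw.add_mem hx.2 hy.2
  zero_mem' := by
    constructor
    · simpa [Pi.zero_def] using C₂.zero_mem
    · simpa [Pi.zero_def] using Cw.zero_mem
  smul_mem' r x hx := by
    constructor
    · simpa [Pi.smul_def] using C₂.smul_mem (R.crt r).1 hx.1
    · simpa [Pi.smul_def] using Cw.smul_mem (R.crt r).2 hx.2

/-- `C` has type `8^k₁ 4^k₂ 4^k₃ 2^k₄ 2^k₅`: as an `R`-module it is a direct sum of cyclic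
modules, `k₁` copies of `R` (8 elements) and `k₂`, `k₃`, `k₄`, `k₅` copies of the ideals
`⟨u⟩` (4 elements), `⟨1 + u⟩` (4 elements), `⟨1 + u²⟩` (2 elements), `⟨u + u²⟩` (2 elements). -/
def HasType {n : ℕ} (C : Submodule R (Fin n → R)) (k₁ k₂ k₃ k₄ k₅ : ℕ) : Prop :=
  Nonempty (C ≃ₗ[R]
    (Fin k₁ → R) ×
    (Fin k₂ → Ideal.span {R.u}) ×
    (Fin k₃ → Ideal.span {1 + R.u}) ×
    (Fin k₄ → Ideal.span {1 + R.u ^ 2}) ×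
    (Fin k₅ → Ideal.span {R.u + R.u ^ 2}))

/-- The Lee distance on `Rⁿ`. -/
def leeDist {n : ℕ} (x y : Fin n → R) : ℕ := ∑ i, (x i - y i).leeWeight

/-- The minimum Lee distance between distinct codewords. -/
def minLeeDist {n : ℕ} (C : Submodule R (Fin n → R)) : ℕ :=
  sInf {d | ∃ x ∈ C, ∃ y ∈ C, x ≠ y ∧ d = leeDist x y}

/-- The Gray map `Rⁿ → F₂³ⁿ`,
`(x₀, …, xₙ₋₁) ↦ (a₀, a₀ + c₀, b₀, …, aₙ₋₁, aₙ₋₁ + cₙ₋₁, bₙ₋₁)`. -/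
def grayMap {n : ℕ} (x : Fin n → R) : Fin (3 * n) → ZMod 2 := fun j =>
  (x ⟨j / 3, Nat.div_lt_of_lt_mul j.isLt⟩).gray ⟨j % 3, Nat.mod_lt _ (by norm_num)⟩

theorem grayMap_add {n : ℕ} (x y : Fin n → R) : grayMap (x + y) = grayMap x + grayMap y := by
  have h : ∀ (p q : R) (k : Fin 3), (p + q).gray k = p.gray k + q.gray k := by
    intro p q k
    fin_cases k
    · simp [R.gray]
    · simp [R.gray]; ring
    · simp [R.gray]
  funext j
  exact h _ _ _

theorem grayMap_zero {n : ℕ} : grayMap (0 : Fin n → R) = 0 := by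
  have h := grayMap_add (0 : Fin n → R) 0
  simpa using h

/-- The Gray image of a linear code over `R`, a binary linear code. -/
def grayCode {n : ℕ} (C : Submodule R (Fin n → R)) :
    Submodule (ZMod 2) (Fin (3 * n) → ZMod 2) where
  carrier := grayMap '' C
  add_mem' := by
    rintro _ _ ⟨x, hx, rfl⟩ ⟨y, hy, rfl⟩
    exact ⟨x + y, C.add_mem hx hy, grayMap_add x y⟩
  zero_mem' := ⟨0, C.zero_mem, grayMap_zero⟩
  smul_mem' := by
    rintro r _ ⟨x, hx, rfl⟩
    have hr : r = 0 ∨ r = 1 := by revert r; decide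
    rcases hr with rfl | rfl
    · exact ⟨0, C.zero_mem, by rw [grayMap_zero, zero_smul]⟩
    · exact ⟨x, hx, by rw [one_smul]⟩

/-! ### Quantum codes on qubits indexed by a finite type -/

section Quantum

variable {ι : Type*} [Fintype ι] [DecidableEq ι]

/-- The state space of the qubits, with orthonormal basis `|x⟩`, `x ∈ F₂^ι`. -/
abbrev Qubits (ι : Type*) [Fintype ι] [DecidableEq ι] : Type _ := EuclideanSpace ℂ (ι → ZMod 2)

/-- The Pauli operator `X^a Z^b`, which maps `|x⟩` to `(-1)^(b·x) |x + a⟩`. -/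
def pauli (a b : ι → ZMod 2) (ψ : Qubits ι) : Qubits ι :=
  WithLp.toLp 2 fun z => (-1 : ℂ) ^ (b ⬝ᵥ (z - a)).val * ψ (z - a)

/-- The weight of `X^a Z^b`: the number of qubits on which it is not the identity. -/
def pauliWeight (a b : ι → ZMod 2) : ℕ :=
  (Finset.univ.filter fun i => a i ≠ 0 ∨ b i ≠ 0).card

/-- The Knill–Laflamme condition: `Q` detects the error `X^a Z^b`, that is,
`P E P` is a multiple of the orthogonal projection `P` onto `Q`. -/
def Detects (Q : Submodule ℂ (Qubits ι)) (a b : ι → ZMod 2) : Prop :=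
  ∃ l : ℂ, ∀ φ ∈ Q, ∀ ψ ∈ Q, inner ℂ φ (pauli a b ψ) = l * inner ℂ φ ψ

/-- `Q` encodes `K` qubits and detects every error of weight less than `d`
(minimum distance at least `d`). -/
def IsQuantumCode (Q : Submodule ℂ (Qubits ι)) (K d : ℕ) : Prop :=
  Module.finrank ℂ Q = 2 ^ K ∧ ∀ a b : ι → ZMod 2, pauliWeight a b < d → Detects Q a b

/-- `Q` encodes `K` qubits and has minimum distance exactly `d`. -/
def IsExactQuantumCode (Q : Submodule ℂ (Qubits ι)) (K d : ℕ) : Prop :=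
  IsQuantumCode Q K d ∧ ∃ a b : ι → ZMod 2, pauliWeight a b = d ∧ ¬ Detects Q a b

/-- The (unnormalized) coset state `∑_{y ∈ B} |x + y⟩`. -/
def cosetState (B : Submodule (ZMod 2) (ι → ZMod 2)) (x : ι → ZMod 2) : Qubits ι :=
  open Classical in WithLp.toLp 2 fun z => if z - x ∈ B then (1 : ℂ) else 0

/-- The CSS code of a pair of binary codes `B ⊆ A`: the span of the states
`∑_{y ∈ B} |x + y⟩`, `x ∈ A`. -/
def cssCode (A B : Submodule (ZMod 2) (ι → ZMod 2)) : Submodule ℂ (Qubits ι) :=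
  Submodule.span ℂ (cosetState B '' A)

end Quantum

end

end CyclicQuantum

open CyclicQuantum
open scoped DualNumber

/-! Under the Gray map `Φ` the dot product of two binary words is the `u²`-coefficient of the dot
product over `R`. That coefficient is a nondegenerate form on `R`, so `Φ` commutes with duality,
and `Φ(C)` contains its dual as soon as `C` does. The CSS code of a binary code `A ⊇ A^⊥` has
dimension `|A / A^⊥|`; it detects `X^a Z^b` whenever `a ∉ A` or `b ∉ A`, and it is fixed pointwise
by `X^a Z^b` with `a, b ∈ A^⊥`, so its distance is at least the minimum weight of `A \ A^⊥`.

The distance is lowered to a prescribed value by conjugation with CNOT gates. One gate changes the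
weight of a Pauli error by at most one, so the distance drops by at most one at a time; since
gates can shorten the support of an undetected bit-flip error `X^x` step by step, it must drop
eventually. -/

namespace CyclicQuantum

/-! ### Duality of linear codes -/

section Duality

variable {F ι : Type*} [Field F] [Fintype ι]

theorem dualCode_eq_orthogonal (A : Submodule F (ι → F)) :
    dualCode A =
      LinearMap.BilinForm.orthogonal (dotProductBilin F F : LinearMap.BilinForm F (ι → F)) A := by
  ext x
  rw [LinearMap.BilinForm.mem_orthogonal_iff]
  exact forall₂_congr fun y _ => by rw [dotProduct_comm]; rfl

theorem nondegenerate_dotProductBilin :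
    (dotProductBilin F F : LinearMap.BilinForm F (ι → F)).Nondegenerate :=
  ⟨fun x hx => dotProduct_eq_zero x hx,
    fun x hx => dotProduct_eq_zero x fun y => (dotProduct_comm x y).trans (hx y)⟩

theorem finrank_add_finrank_dualCode (A : Submodule F (ι → F)) :
    Module.finrank F A + Module.finrank F (dualCode A) = Fintype.card ι := by
  have hA := A.finrank_le
  rw [Module.finrank_fintype_fun_eq_card] at hA
  rw [dualCode_eq_orthogonal, LinearMap.BilinForm.finrank_orthogonal nondegenerate_dotProductBilin,
    Module.finrank_fintype_fun_eq_card, Nat.add_sub_cancel' hA]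

theorem dualCode_dualCode (A : Submodule F (ι → F)) : dualCode (dualCode A) = A := by
  rw [dualCode_eq_orthogonal, dualCode_eq_orthogonal]
  exact LinearMap.BilinForm.orthogonal_orthogonal nondegenerate_dotProductBilin
    (fun x y h => (dotProduct_comm y x).trans h) A

theorem card_le_two_mul_finrank {A : Submodule F (ι → F)} (hA : dualCode A ≤ A) :
    Fintype.card ι ≤ 2 * Module.finrank F A := by
  have hle := Submodule.finrank_mono hA
  have hsum := finrank_add_finrank_dualCode A
  omega

theorem exists_mem_notMem_dualCode {A : Submodule F (ι → F)}
    (hA : Fintype.card ι < 2 * Module.finrank F A) : ∃ x ∈ A, x ∉ dualCode A := by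
  refine SetLike.not_le_iff_exists.1 fun h => ?_
  have hle := Submodule.finrank_mono h
  have hsum := finrank_add_finrank_dualCode A
  omega

end Duality

/-! ### Pauli operators -/

theorem neg_one_pow_val_add {S : Type*} [Ring S] (s t : ZMod 2) :
    (-1 : S) ^ (s + t).val = (-1) ^ s.val * (-1) ^ t.val := by
  rw [ZMod.val_add, ← neg_one_pow_eq_pow_mod_two, pow_add]

theorem eq_one_of_ne_zero {r : ZMod 2} : r ≠ 0 → r = 1 := by
  revert r; decide

section PauliWeight

variable {ι : Type*} [Fintype ι]

theorem pauliWeight_zero_right (a : ι → ZMod 2) : pauliWeight a 0 = hammingNorm a := by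
  simp [pauliWeight, hammingNorm]

theorem hammingNorm_left_le_pauliWeight (a b : ι → ZMod 2) : hammingNorm a ≤ pauliWeight a b :=
  Finset.card_le_card <| Finset.monotone_filter_right _ fun _ _ => Or.inl

theorem hammingNorm_right_le_pauliWeight (a b : ι → ZMod 2) : hammingNorm b ≤ pauliWeight a b :=
  Finset.card_le_card <| Finset.monotone_filter_right _ fun _ _ => Or.inr

end PauliWeight

section Pauli

variable {ι : Type*} [Fintype ι] [DecidableEq ι]

theorem pauli_apply (a b : ι → ZMod 2) (ψ : Qubits ι) (z : ι → ZMod 2) :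
    pauli a b ψ z = (-1 : ℂ) ^ (b ⬝ᵥ (z - a)).val * ψ (z - a) := rfl

theorem inner_pauli (a b : ι → ZMod 2) (φ ψ : Qubits ι) :
    inner ℂ φ (pauli a b ψ) =
      ∑ z, (-1 : ℂ) ^ (b ⬝ᵥ (z - a)).val * ψ (z - a) * (starRingEnd ℂ) (φ z) := by
  simp [PiLp.inner_apply, pauli_apply]

theorem IsQuantumCode.isExactQuantumCode_or_succ {Q : Submodule ℂ (Qubits ι)} {K d : ℕ}
    (hQ : IsQuantumCode Q K d) : IsExactQuantumCode Q K d ∨ IsQuantumCode Q K (d + 1) := by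
  by_cases h : ∃ a b : ι → ZMod 2, pauliWeight a b = d ∧ ¬ Detects Q a b
  · exact Or.inl ⟨hQ, h⟩
  · push Not at h
    exact Or.inr ⟨hQ.1, fun a b hab => (Nat.lt_succ_iff_lt_or_eq.1 hab).elim (hQ.2 a b) (h a b)⟩

end Pauli

/-! ### CNOT gates -/

section Cnot

variable {ι : Type*} [DecidableEq ι]

/-- The action on `F₂^ι` of the CNOT gate with control `i` and target `j`. -/
def cnot (i j : ι) (x : ι → ZMod 2) : ι → ZMod 2 := x + Pi.single j (x i)

theorem cnot_apply_target (i j : ι) (x : ι → ZMod 2) : cnot i j x j = x j + x i := by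
  simp [cnot]

theorem cnot_apply_of_ne {i j k : ι} (h : k ≠ j) (x : ι → ZMod 2) : cnot i j x k = x k := by
  simp [cnot, h]

theorem cnot_eq_self {i : ι} {x : ι → ZMod 2} (h : x i = 0) (j : ι) : cnot i j x = x := by
  simp [cnot, h]

theorem cnot_sub (i j : ι) (x y : ι → ZMod 2) : cnot i j (x - y) = cnot i j x - cnot i j y := by
  simp only [cnot, Pi.sub_apply, Pi.single_sub]
  abel

theorem cnot_involutive {i j : ι} (h : i ≠ j) : Function.Involutive (cnot i j) := fun x => by
  rw [cnot, cnot_apply_of_ne h, cnot, add_assoc, ← Pi.single_add, CharTwo.add_self_eq_zero,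
    Pi.single_zero, add_zero]

variable [Fintype ι]

theorem dotProduct_cnot (i j : ι) (b x : ι → ZMod 2) : b ⬝ᵥ cnot i j x = cnot j i b ⬝ᵥ x := by
  simp [cnot, dotProduct_add, add_dotProduct]

theorem hammingNorm_cnot_lt {i j : ι} (h : i ≠ j) {x : ι → ZMod 2} (hi : x i ≠ 0) (hj : x j ≠ 0) :
    hammingNorm (cnot i j x) < hammingNorm x := by
  have target_eq_zero : cnot i j x j = 0 := by
    rw [cnot_apply_target, eq_one_of_ne_zero hi, eq_one_of_ne_zero hj, CharTwo.add_self_eq_zero]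
  refine Finset.card_lt_card ((Finset.ssubset_iff_of_subset fun k hk => ?_).2
    ⟨j, by simpa using hj, by simpa using target_eq_zero⟩)
  rcases eq_or_ne k j with rfl | hkj
  · simpa using hj
  · simpa [cnot_apply_of_ne hkj] using hk

theorem pauliWeight_cnot_le (i j : ι) (a b : ι → ZMod 2) :
    pauliWeight (cnot i j a) (cnot j i b) ≤ pauliWeight a b + 1 := by
  unfold pauliWeight
  set S := Finset.univ.filter fun k => a k ≠ 0 ∨ b k ≠ 0 with hS
  have support_subset :
      (Finset.univ.filter fun k => cnot i j a k ≠ 0 ∨ cnot j i b k ≠ 0) ⊆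
        insert i (insert j S) := by
    intro k hk
    by_cases hki : k = i
    · simp [hki]
    by_cases hkj : k = j
    · simp [hkj]
    simpa [hki, hkj, hS, cnot_apply_of_ne] using hk
  by_cases hi : a i = 0
  · by_cases hj : b j = 0
    · rw [cnot_eq_self hi, cnot_eq_self hj]
      exact Nat.le_succ _
    · have hjS : j ∈ S := by simp [hS, hj]
      rw [Finset.insert_eq_of_mem hjS] at support_subset
      exact (Finset.card_le_card support_subset).trans (Finset.card_insert_le _ _)
  · have hiS : i ∈ S := by simp [hS, hi]
    rw [Finset.insert_comm, Finset.insert_eq_of_mem hiS] at support_subset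
    exact (Finset.card_le_card support_subset).trans (Finset.card_insert_le _ _)

/-- The CNOT gate as a unitary operator, used to conjugate quantum codes. -/
noncomputable def cnotGate {i j : ι} (h : i ≠ j) : Qubits ι ≃ₗᵢ[ℂ] Qubits ι :=
  LinearIsometryEquiv.piLpCongrLeft 2 ℂ ℂ (cnot_involutive h).toPerm

theorem cnotGate_apply {i j : ι} (h : i ≠ j) (ψ : Qubits ι) (z : ι → ZMod 2) :
    cnotGate h ψ z = ψ (cnot i j z) := rfl

theorem pauli_cnotGate {i j : ι} (h : i ≠ j) (a b : ι → ZMod 2) (ψ : Qubits ι) :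
    pauli a b (cnotGate h ψ) = cnotGate h (pauli (cnot i j a) (cnot j i b) ψ) := by
  ext z
  rw [cnotGate_apply, pauli_apply, pauli_apply, cnotGate_apply, ← dotProduct_cnot, ← cnot_sub,
    cnot_involutive h]

theorem detects_map_cnotGate {i j : ι} (h : i ≠ j) (Q : Submodule ℂ (Qubits ι))
    (a b : ι → ZMod 2) :
    Detects (Q.map (cnotGate h).toLinearEquiv.toLinearMap) a b ↔
      Detects Q (cnot i j a) (cnot j i b) := by
  simp only [Detects, Submodule.mem_map, forall_exists_index, and_imp, forall_apply_eq_imp_iff₂,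
    LinearEquiv.coe_coe, LinearIsometryEquiv.coe_toLinearEquiv, pauli_cnotGate,
    LinearIsometryEquiv.inner_map_map]

theorem IsQuantumCode.map_cnotGate {Q : Submodule ℂ (Qubits ι)} {K d : ℕ}
    (hQ : IsQuantumCode Q K (d + 1)) {i j : ι} (h : i ≠ j) :
    IsQuantumCode (Q.map (cnotGate h).toLinearEquiv.toLinearMap) K d := by
  refine ⟨(LinearEquiv.finrank_map_eq _ Q).trans hQ.1, fun a b hab => ?_⟩
  rw [detects_map_cnotGate]
  exact hQ.2 _ _ ((pauliWeight_cnot_le i j a b).trans_lt (Nat.succ_lt_succ hab))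

theorem IsQuantumCode.exists_isExactQuantumCode {K d : ℕ} (hd : 1 ≤ d)
    {Q : Submodule ℂ (Qubits ι)} (hQ : IsQuantumCode Q K d)
    {x : ι → ZMod 2} (hx : ¬ Detects Q x 0) :
    ∃ Q' : Submodule ℂ (Qubits ι), IsExactQuantumCode Q' K d := by
  induction hw : hammingNorm x using Nat.strong_induction_on generalizing Q x with
  | _ w ih =>
    subst hw
    rcases hQ.isExactQuantumCode_or_succ with hexact | hsucc
    · exact ⟨Q, hexact⟩
    have lt_weight : d < hammingNorm x := by
      by_contra! hle
      exact hx (hsucc.2 x 0 (by rw [pauliWeight_zero_right]; exact Nat.lt_succ_of_le hle))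
    obtain ⟨i, hi, j, hj, hij⟩ := Finset.one_lt_card.1 (hd.trans_lt lt_weight)
    rw [Finset.mem_filter_univ] at hi hj
    refine ih _ (hammingNorm_cnot_lt hij hi hj) (hsucc.map_cnotGate hij) ?_ rfl
    rwa [detects_map_cnotGate, cnot_involutive hij, cnot_eq_self (Pi.zero_apply j)]

end Cnot

/-! ### CSS codes -/

section Css

variable {ι : Type*} [Fintype ι] [DecidableEq ι]

section CosetState

variable {B : Submodule (ZMod 2) (ι → ZMod 2)} {x y z : ι → ZMod 2}

theorem cosetState_apply_of_mem (h : z - x ∈ B) : cosetState B x z = 1 := by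
  simp [cosetState, h]

theorem cosetState_apply_of_notMem (h : z - x ∉ B) : cosetState B x z = 0 := by
  simp [cosetState, h]

theorem cosetState_apply_congr {t : ι → ZMod 2} (h : z - x ∈ B ↔ t - y ∈ B) :
    cosetState B x z = cosetState B y t := by
  by_cases hz : z - x ∈ B
  · rw [cosetState_apply_of_mem hz, cosetState_apply_of_mem (h.1 hz)]
  · rw [cosetState_apply_of_notMem hz, cosetState_apply_of_notMem (mt h.2 hz)]

theorem cosetState_eq_of_sub_mem (h : x - y ∈ B) : cosetState B x = cosetState B y := by
  ext z
  exact cosetState_apply_congr (by rw [← sub_add_sub_cancel z x y, B.add_mem_iff_left h])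

theorem cosetState_ne_zero (B : Submodule (ZMod 2) (ι → ZMod 2)) (x : ι → ZMod 2) :
    cosetState B x ≠ 0 := by
  intro h
  have value_eq_one : cosetState B x x = 1 := cosetState_apply_of_mem (by simp)
  simp [h] at value_eq_one

theorem inner_cosetState_eq_zero (h : x - y ∉ B) :
    inner ℂ (cosetState B x) (cosetState B y) = 0 := by
  rw [PiLp.inner_apply]
  refine Finset.sum_eq_zero fun z _ => ?_
  by_cases hx : z - x ∈ B
  · have hy : z - y ∉ B := fun hy => h (by simpa using B.sub_mem hy hx)
    rw [cosetState_apply_of_notMem hy, inner_zero_right]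
  · rw [cosetState_apply_of_notMem hx, inner_zero_left]

theorem pauli_cosetState (B : Submodule (ZMod 2) (ι → ZMod 2)) (a x : ι → ZMod 2) :
    pauli a 0 (cosetState B x) = cosetState B (x + a) := by
  ext z
  rw [pauli_apply, zero_dotProduct, ZMod.val_zero, pow_zero, one_mul]
  exact cosetState_apply_congr (by rw [sub_sub, add_comm])

/-- The coset state as a function on `F₂^ι / B`, where it becomes injective; the images of the
cosets contained in `A` are then a basis of `cssCode A B`. -/
noncomputable def quotientState (B : Submodule (ZMod 2) (ι → ZMod 2)) :
    ((ι → ZMod 2) ⧸ B) → Qubits ι :=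
  Quotient.lift (cosetState B) fun _ _ h => cosetState_eq_of_sub_mem (B.quotientRel_def.1 h)

theorem quotientState_mkQ (B : Submodule (ZMod 2) (ι → ZMod 2)) (x : ι → ZMod 2) :
    quotientState B (B.mkQ x) = cosetState B x := rfl

theorem linearIndependent_quotientState (B : Submodule (ZMod 2) (ι → ZMod 2)) :
    LinearIndependent ℂ (quotientState B) := by
  refine linearIndependent_of_ne_zero_of_inner_eq_zero (fun q => ?_) fun p q hpq => ?_
  · obtain ⟨x, rfl⟩ := B.mkQ_surjective q
    exact cosetState_ne_zero B x
  · obtain ⟨x, rfl⟩ := B.mkQ_surjective p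
    obtain ⟨y, rfl⟩ := B.mkQ_surjective q
    exact inner_cosetState_eq_zero fun h => hpq ((Submodule.Quotient.eq B).2 h)

end CosetState

section CssCode

theorem finrank_map_mkQ_add_finrank {F V : Type*} [DivisionRing F] [AddCommGroup V]
    [Module F V] [FiniteDimensional F V] {A B : Submodule F V} (hBA : B ≤ A) :
    Module.finrank F (A.map B.mkQ) + Module.finrank F B = Module.finrank F A := by
  have h := (B.mkQ.domRestrict A).finrank_range_add_finrank_ker
  rwa [LinearMap.range_domRestrict, LinearMap.ker_domRestrict, Submodule.ker_mkQ,
    (Submodule.comapSubtypeEquivOfLe hBA).finrank_eq] at h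

variable {A B : Submodule (ZMod 2) (ι → ZMod 2)}

theorem finrank_cssCode (A B : Submodule (ZMod 2) (ι → ZMod 2)) :
    Module.finrank ℂ (cssCode A B) = 2 ^ Module.finrank (ZMod 2) (A.map B.mkQ) := by
  have hspan : cssCode A B =
      Submodule.span ℂ (Set.range fun q : A.map B.mkQ => quotientState B q) := by
    refine congrArg (Submodule.span ℂ) (Set.ext fun ψ => ⟨?_, ?_⟩)
    · rintro ⟨x, hx, rfl⟩
      exact ⟨⟨B.mkQ x, Submodule.mem_map_of_mem hx⟩, quotientState_mkQ B x⟩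
    · rintro ⟨⟨_, x, hx, rfl⟩, rfl⟩
      exact ⟨x, hx, (quotientState_mkQ B x).symm⟩
  have := Fintype.ofFinite (A.map B.mkQ)
  have hli := (linearIndependent_quotientState B).comp _
    (Subtype.val_injective (p := (· ∈ A.map B.mkQ)))
  rw [hspan]
  refine (finrank_span_eq_card hli).trans ?_
  rw [Module.card_eq_pow_finrank (K := ZMod 2), ZMod.card]

theorem cosetState_mem_cssCode {x : ι → ZMod 2} (hx : x ∈ A) : cosetState B x ∈ cssCode A B :=
  Submodule.subset_span ⟨x, hx, rfl⟩

theorem apply_eq_zero_of_mem_cssCode (hBA : B ≤ A) {ψ : Qubits ι} (hψ : ψ ∈ cssCode A B)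
    {z : ι → ZMod 2} (hz : z ∉ A) : ψ z = 0 := by
  induction hψ using Submodule.span_induction with
  | mem ψ h =>
    obtain ⟨x, hx, rfl⟩ := h
    exact cosetState_apply_of_notMem fun h => hz ((A.sub_mem_iff_left hx).1 (hBA h))
  | zero => rfl
  | add φ ψ _ _ hφ hψ => simp [hφ, hψ]
  | smul c ψ _ hψ => simp [hψ]

theorem apply_add_of_mem_cssCode {ψ : Qubits ι} (hψ : ψ ∈ cssCode A B)
    {y : ι → ZMod 2} (hy : y ∈ B) (z : ι → ZMod 2) : ψ (z + y) = ψ z := by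
  induction hψ using Submodule.span_induction with
  | mem ψ h =>
    obtain ⟨x, -, rfl⟩ := h
    exact cosetState_apply_congr (by rw [add_sub_right_comm, B.add_mem_iff_left hy])
  | zero => rfl
  | add φ ψ _ _ hφ hψ => simp [hφ, hψ]
  | smul c ψ _ hψ => simp [hψ]

theorem detects_cssCode_of_notMem (hBA : B ≤ A) {a : ι → ZMod 2} (ha : a ∉ A)
    (b : ι → ZMod 2) : Detects (cssCode A B) a b := by
  refine ⟨0, fun φ hφ ψ hψ => ?_⟩
  rw [inner_pauli, zero_mul]
  refine Finset.sum_eq_zero fun z _ => ?_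
  by_cases hz : z ∈ A
  · have hza : z - a ∉ A := fun h => ha ((A.sub_mem_iff_right hz).1 h)
    rw [apply_eq_zero_of_mem_cssCode hBA hψ hza, mul_zero, zero_mul]
  · rw [apply_eq_zero_of_mem_cssCode hBA hφ hz, map_zero, mul_zero]

theorem detects_cssCode_of_notMem_dualCode (a : ι → ZMod 2) {b : ι → ZMod 2}
    (hb : b ∉ dualCode B) : Detects (cssCode A B) a b := by
  obtain ⟨y, hy, hby⟩ : ∃ y ∈ B, b ⬝ᵥ y ≠ 0 := by
    by_contra! h
    exact hb h
  refine ⟨0, fun φ hφ ψ hψ => ?_⟩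
  -- The substitution `z ↦ z + y` reverses the sign of every summand.
  rw [inner_pauli, zero_mul, ← self_eq_neg, ← Finset.sum_neg_distrib,
    ← Equiv.sum_comp (Equiv.addRight y)]
  refine Finset.sum_congr rfl fun z _ => ?_
  rw [Equiv.coe_addRight, add_sub_right_comm, apply_add_of_mem_cssCode hψ hy,
    apply_add_of_mem_cssCode hφ hy, dotProduct_add, neg_one_pow_val_add, eq_one_of_ne_zero hby,
    ZMod.val_one]
  ring

theorem pauli_eq_self_of_mem_cssCode (hBA : B ≤ A) {a b : ι → ZMod 2} (ha : a ∈ B)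
    (hb : b ∈ dualCode A) {ψ : Qubits ι} (hψ : ψ ∈ cssCode A B) : pauli a b ψ = ψ := by
  ext z
  have hza : ψ (z - a) = ψ z := by
    rw [sub_eq_add_neg, apply_add_of_mem_cssCode hψ (B.neg_mem ha)]
  rw [pauli_apply]
  by_cases hz : z - a ∈ A
  · rw [hb _ hz, ZMod.val_zero, pow_zero, one_mul, hza]
  · rw [← hza, apply_eq_zero_of_mem_cssCode hBA hψ hz, mul_zero]

theorem not_detects_cssCode {x : ι → ZMod 2} (hxA : x ∈ A) (hxB : x ∉ B) :
    ¬ Detects (cssCode A B) x 0 := by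
  rintro ⟨l, hl⟩
  have hinner := hl _ (cosetState_mem_cssCode hxA) _ (cosetState_mem_cssCode A.zero_mem)
  rw [pauli_cosetState, zero_add, inner_cosetState_eq_zero (y := 0) (by rwa [sub_zero]),
    mul_zero, inner_self_eq_zero] at hinner
  exact cosetState_ne_zero B x hinner

theorem isQuantumCode_cssCode (hBA : B ≤ A) {K d : ℕ}
    (hK : Module.finrank (ZMod 2) A = K + Module.finrank (ZMod 2) B)
    (hX : ∀ x ∈ A, x ∉ B → d ≤ hammingNorm x)
    (hZ : ∀ x ∈ dualCode B, x ∉ dualCode A → d ≤ hammingNorm x) :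
    IsQuantumCode (cssCode A B) K d := by
  refine ⟨?_, fun a b hab => ?_⟩
  · rw [finrank_cssCode, Nat.add_right_cancel ((finrank_map_mkQ_add_finrank hBA).trans hK)]
  by_cases haA : a ∈ A
  swap
  · exact detects_cssCode_of_notMem hBA haA b
  by_cases hbB : b ∈ dualCode B
  swap
  · exact detects_cssCode_of_notMem_dualCode a hbB
  have haB : a ∈ B := by
    by_contra h
    exact ((hX a haA h).trans (hammingNorm_left_le_pauliWeight a b)).not_gt hab
  have hbA : b ∈ dualCode A := by
    by_contra h
    exact ((hZ b hbB h).trans (hammingNorm_right_le_pauliWeight a b)).not_gt hab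
  exact ⟨1, fun φ _ ψ hψ => by rw [pauli_eq_self_of_mem_cssCode hBA haB hbA hψ, one_mul]⟩

theorem isQuantumCode_cssCode_dualCode (hA : dualCode A ≤ A) {K d : ℕ}
    (hK : 2 * Module.finrank (ZMod 2) A = K + Fintype.card ι)
    (hd : ∀ x ∈ A, x ∉ dualCode A → d ≤ hammingNorm x) :
    IsQuantumCode (cssCode A (dualCode A)) K d := by
  have hsum := finrank_add_finrank_dualCode A
  exact isQuantumCode_cssCode hA (by omega) hd (by rwa [dualCode_dualCode])

end CssCode

end Css

/-! ### The Gray map -/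

namespace R

/-- The Gray map as a bijection, which also transfers finiteness and decidable equality to `R`. -/
def grayEquiv : R ≃ (Fin 3 → ZMod 2) where
  toFun := gray
  invFun v := ⟨v 0, v 2, v 0 + v 1⟩
  left_inv x := by ext <;> simp [gray, ← add_assoc, CharTwo.add_self_eq_zero]
  right_inv v := by
    ext k
    fin_cases k <;> simp [gray, ← add_assoc, CharTwo.add_self_eq_zero]

instance : DecidableEq R := grayEquiv.decidableEq

instance : Fintype R := Fintype.ofEquiv _ grayEquiv.symm

theorem natCard : Nat.card R = 2 ^ 3 := by
  rw [Nat.card_congr grayEquiv]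
  simp

theorem gray_dotProduct_gray (x y : R) : x.gray ⬝ᵥ y.gray = (x * y).c := by
  have h : ∀ a b c a' b' c' : ZMod 2, a * a' + (a + c) * (a' + c') + b * b' =
      a * c' + b * b' + c * a' + c * c' := by decide
  simpa [gray, dotProduct, Fin.sum_univ_three] using h x.a x.b x.c y.a y.b y.c

theorem sum_c {ι : Type*} (s : Finset ι) (f : ι → R) : (∑ i ∈ s, f i).c = ∑ i ∈ s, (f i).c :=
  map_sum (⟨⟨R.c, rfl⟩, fun _ _ => rfl⟩ : R →+ ZMod 2) f s

theorem eq_zero_of_forall_mul_c {s : R} (h : ∀ r : R, (r * s).c = 0) : s = 0 := by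
  have hc : s.c = 0 := by simpa using h 1
  have hb : s.b = 0 := by simpa [u] using h u
  have ha : s.a = 0 := by simpa [u, hc] using h (u * u)
  exact R.ext ha hb hc

end R

section GrayMap

variable {n : ℕ}

/-- The index `3 i + k` of the `k`-th bit of the `i`-th block of a Gray image. -/
def grayIndex (n : ℕ) : Fin n × Fin 3 ≃ Fin (3 * n) :=
  finProdFinEquiv.trans (finCongr (mul_comm n 3))

theorem grayMap_grayIndex (x : Fin n → R) (i : Fin n) (k : Fin 3) :
    grayMap x (grayIndex n (i, k)) = (x i).gray k := by
  have hdiv : (⟨grayIndex n (i, k) / 3, Nat.div_lt_of_lt_mul (grayIndex n (i, k)).isLt⟩ : Fin n)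
      = i := by
    ext
    simp only [grayIndex, Equiv.trans_apply, finProdFinEquiv_apply_val, finCongr_apply,
      Fin.val_cast]
    omega
  have hmod : (⟨grayIndex n (i, k) % 3, Nat.mod_lt _ (by norm_num)⟩ : Fin 3) = k := by
    ext
    simp [grayIndex]
  simp only [grayMap, hdiv, hmod]

theorem grayMap_bijective : Function.Bijective (grayMap (n := n)) := by
  constructor
  · intro x y h
    refine funext fun i => R.grayEquiv.injective (funext fun k => ?_)
    exact (grayMap_grayIndex x i k).symm.trans
      ((congrFun h (grayIndex n (i, k))).trans (grayMap_grayIndex y i k))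
  · intro v
    choose x hx using fun i => R.grayEquiv.surjective fun k => v (grayIndex n (i, k))
    refine ⟨x, funext fun j => ?_⟩
    obtain ⟨⟨i, k⟩, rfl⟩ := (grayIndex n).surjective j
    exact (grayMap_grayIndex x i k).trans (congrFun (hx i) k)

theorem grayMap_dotProduct (x y : Fin n → R) : grayMap x ⬝ᵥ grayMap y = (x ⬝ᵥ y).c := by
  simp only [dotProduct, R.sum_c]
  rw [← (grayIndex n).sum_comp, Fintype.sum_prod_type]
  simp only [grayMap_grayIndex]
  exact Finset.sum_congr rfl fun i _ => R.gray_dotProduct_gray (x i) (y i)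

theorem hammingNorm_grayMap (x : Fin n → R) :
    hammingNorm (grayMap x) = ∑ i, (x i).leeWeight := by
  simp only [R.leeWeight, hammingNorm, Finset.card_filter]
  rw [← (grayIndex n).sum_comp, Fintype.sum_prod_type]
  simp only [grayMap_grayIndex]

theorem grayCode_mono {C D : Submodule R (Fin n → R)} (h : C ≤ D) : grayCode C ≤ grayCode D :=
  Set.image_mono h

theorem dualCode_grayCode (C : Submodule R (Fin n → R)) :
    dualCode (grayCode C) = grayCode (dualCode C) := by
  ext v
  obtain ⟨x, rfl⟩ := grayMap_bijective.2 v
  constructor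
  · refine fun h => ⟨x, fun y hy => R.eq_zero_of_forall_mul_c fun r => ?_, rfl⟩
    rw [← smul_eq_mul, ← dotProduct_smul, ← grayMap_dotProduct]
    exact h _ ⟨r • y, C.smul_mem r hy, rfl⟩
  · rintro ⟨x', hx', hxx'⟩ _ ⟨y, hy, rfl⟩
    rw [← hxx', grayMap_dotProduct, hx' y hy, R.zero_c]

theorem natCard_grayCode (C : Submodule R (Fin n → R)) : Nat.card (grayCode C) = Nat.card C :=
  Nat.card_image_of_injective grayMap_bijective.1 (C : Set (Fin n → R))

/-! ### The minimum Lee distance -/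

theorem leeDist_eq_hammingNorm (x y : Fin n → R) :
    leeDist x y = hammingNorm (grayMap (x - y)) :=
  (hammingNorm_grayMap (x - y)).symm

theorem minLeeDist_le_hammingNorm {C : Submodule R (Fin n → R)} {v : Fin (3 * n) → ZMod 2}
    (hv : v ∈ grayCode C) (hv0 : v ≠ 0) : minLeeDist C ≤ hammingNorm v := by
  obtain ⟨x, hx, rfl⟩ := hv
  refine Nat.sInf_le ⟨x, hx, 0, C.zero_mem, ?_, ?_⟩
  · rintro rfl
    exact hv0 grayMap_zero
  · rw [leeDist_eq_hammingNorm, sub_zero]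

theorem one_le_minLeeDist {C : Submodule R (Fin n → R)} (hC : C ≠ ⊥) : 1 ≤ minLeeDist C := by
  obtain ⟨x, hx, hx0⟩ := C.exists_mem_ne_zero_of_ne_bot hC
  obtain ⟨y, -, z, -, hyz, hd⟩ : minLeeDist C ∈ {d | ∃ x ∈ C, ∃ y ∈ C, x ≠ y ∧ d = leeDist x y} :=
    Nat.sInf_mem ⟨_, x, hx, 0, C.zero_mem, hx0, rfl⟩
  rw [hd, leeDist_eq_hammingNorm, Nat.one_le_iff_ne_zero, hammingNorm_ne_zero_iff,
    ← grayMap_zero, grayMap_bijective.1.ne_iff]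
  exact sub_ne_zero.2 hyz

theorem ne_bot_of_mem_grayCode {C : Submodule R (Fin n → R)} {v : Fin (3 * n) → ZMod 2}
    (hv : v ∈ grayCode C) (hv0 : v ≠ 0) : C ≠ ⊥ := by
  rintro rfl
  obtain ⟨x, hx, rfl⟩ := hv
  rw [(Submodule.mem_bot R).1 hx] at hv0
  exact hv0 grayMap_zero

end GrayMap

/-! ### Codes of a given type -/

theorem natCard_span_singleton {S : Type*} [CommRing S] [Fintype S] [DecidableEq S] (r : S) :
    Nat.card (Ideal.span {r}) = (Finset.univ.image fun x => x * r).card := by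
  rw [← Nat.card_eq_finsetCard]
  exact Nat.card_congr (Equiv.subtypeEquivRight fun x => by
    simp [Ideal.mem_span_singleton', eq_comm])

theorem R.natCard_span_u : Nat.card (Ideal.span {u}) = 2 ^ 2 := by
  rw [natCard_span_singleton]; decide

theorem R.natCard_span_one_add_u : Nat.card (Ideal.span {1 + u}) = 2 ^ 2 := by
  rw [natCard_span_singleton]; decide

theorem R.natCard_span_one_add_u_sq : Nat.card (Ideal.span {1 + u ^ 2}) = 2 ^ 1 := by
  rw [natCard_span_singleton, pow_two]; decide

theorem R.natCard_span_u_add_u_sq : Nat.card (Ideal.span {u + u ^ 2}) = 2 ^ 1 := by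
  rw [natCard_span_singleton, pow_two]; decide

section HasType

variable {n : ℕ} {C : Submodule R (Fin n → R)} {k₁ k₂ k₃ k₄ k₅ : ℕ}

theorem HasType.natCard (h : HasType C k₁ k₂ k₃ k₄ k₅) :
    Nat.card C = 2 ^ (3 * k₁ + 2 * (k₂ + k₃) + (k₄ + k₅)) := by
  obtain ⟨e⟩ := h
  rw [Nat.card_congr e.toEquiv]
  simp only [Nat.card_prod, Nat.card_fun, Nat.card_fin, R.natCard, R.natCard_span_u,
    R.natCard_span_one_add_u, R.natCard_span_one_add_u_sq, R.natCard_span_u_add_u_sq,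
    ← pow_mul, ← pow_add]
  congr 1
  ring

theorem HasType.finrank_grayCode (h : HasType C k₁ k₂ k₃ k₄ k₅) :
    Module.finrank (ZMod 2) (grayCode C) = 3 * k₁ + 2 * (k₂ + k₃) + (k₄ + k₅) := by
  have hcard := Module.natCard_eq_pow_finrank (K := ZMod 2) (V := grayCode C)
  rw [natCard_grayCode, h.natCard, Nat.card_zmod] at hcard
  exact (Nat.pow_right_injective le_rfl hcard).symm

end HasType

/-! ### Codes built by the Chinese remainder theorem -/

theorem R.crt_dotProduct {ι : Type*} [Fintype ι] (x y : ι → R) :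
    R.crt (x ⬝ᵥ y) =
      ((fun i => (R.crt (x i)).1) ⬝ᵥ fun i => (R.crt (y i)).1,
        (fun i => (R.crt (x i)).2) ⬝ᵥ fun i => (R.crt (y i)).2) := by
  simp [dotProduct, map_sum, Prod.ext_iff, Prod.fst_sum, Prod.snd_sum]

section CrtCode

variable {n : ℕ}

theorem crtCode_mono {C₂ D₂ : Submodule (ZMod 2) (Fin n → ZMod 2)}
    {Cw Dw : Submodule (ZMod 2)[ε] (Fin n → (ZMod 2)[ε])} (h₂ : C₂ ≤ D₂) (hw : Cw ≤ Dw) :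
    crtCode C₂ Cw ≤ crtCode D₂ Dw :=
  fun _ hx => ⟨h₂ hx.1, hw hx.2⟩

theorem dualCode_crtCode (C₂ : Submodule (ZMod 2) (Fin n → ZMod 2))
    (Cw : Submodule (ZMod 2)[ε] (Fin n → (ZMod 2)[ε])) :
    dualCode (crtCode C₂ Cw) = crtCode (dualCode C₂) (dualCode Cw) := by
  ext x
  constructor
  · intro hx
    have hdot : ∀ y ∈ C₂, ∀ z ∈ Cw, ((fun i => (R.crt (x i)).1) ⬝ᵥ y,
        (fun i => (R.crt (x i)).2) ⬝ᵥ z) = (0 : ZMod 2 × (ZMod 2)[ε]) := by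
      intro y hy z hz
      have hmem : (fun i => R.crt.symm (y i, z i)) ∈ crtCode C₂ Cw := by
        constructor <;> simpa
      simpa only [R.crt_dotProduct, RingEquiv.apply_symm_apply, map_zero] using
        congrArg R.crt (hx _ hmem)
    exact ⟨fun y hy => congrArg Prod.fst (hdot y hy 0 Cw.zero_mem),
      fun z hz => congrArg Prod.snd (hdot 0 C₂.zero_mem z hz)⟩
  · rintro ⟨hx₂, hxw⟩ y ⟨hy₂, hyw⟩
    apply R.crt.injective
    rw [R.crt_dotProduct, hx₂ _ hy₂, hxw _ hyw, map_zero, Prod.mk_zero_zero]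

end CrtCode

end CyclicQuantum

theorem theorem10_general {n : ℕ} {C₂ : Submodule (ZMod 2) (Fin n → ZMod 2)}
    {Cw : Submodule (ZMod 2)[ε] (Fin n → (ZMod 2)[ε])}
    {C : Submodule R (Fin n → R)} (hC : C = crtCode C₂ Cw)
    {k₁ k₂ k₃ k₄ k₅ : ℕ} (htype : HasType C k₁ k₂ k₃ k₄ k₅)
    (h₂ : dualCode C₂ ≤ C₂) (hw : dualCode Cw ≤ Cw) :
    dualCode C ≤ C ∧
    ∃ K : ℕ, (K : ℤ) = 6 * k₁ + 4 * (k₂ + k₃) + 2 * (k₄ + k₅) - 3 * n ∧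
      (dualCode (grayCode C) ≤ grayCode C ∧
        IsQuantumCode (cssCode (grayCode C) (dualCode (grayCode C))) K (minLeeDist C)) ∧
      (0 < K → ∃ Q : Submodule ℂ (Qubits (Fin (3 * n))),
        IsExactQuantumCode Q K (minLeeDist C)) := by
  have hdual : dualCode C ≤ C := by
    rw [hC, dualCode_crtCode]
    exact crtCode_mono h₂ hw
  have hgray : dualCode (grayCode C) ≤ grayCode C := by
    rw [dualCode_grayCode]
    exact grayCode_mono hdual
  obtain ⟨K, hK⟩ := Nat.exists_eq_add_of_le' (card_le_two_mul_finrank hgray)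
  have ne_zero : ∀ v ∉ dualCode (grayCode C), v ≠ 0 := fun v hv h =>
    hv (h ▸ Submodule.zero_mem _)
  have hcss := isQuantumCode_cssCode_dualCode hgray hK fun v hv hv' =>
    minLeeDist_le_hammingNorm hv (ne_zero v hv')
  refine ⟨hdual, K, ?_, ⟨hgray, hcss⟩, fun hpos => ?_⟩
  · rw [htype.finrank_grayCode, Fintype.card_fin] at hK
    omega
  · obtain ⟨v, hv, hv'⟩ := exists_mem_notMem_dualCode (A := grayCode C) (by omega)
    exact hcss.exists_isExactQuantumCode
      (one_le_minLeeDist (ne_bot_of_mem_grayCode hv (ne_zero v hv'))) (not_detects_cssCode hv hv')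

theorem theorem10 (n : ℕ) (hn : Odd n)
    (C₂ : Submodule (ZMod 2) (Fin n → ZMod 2))
    (Cw : Submodule (ZMod 2)[ε] (Fin n → (ZMod 2)[ε]))
    (C : Submodule R (Fin n → R)) (hC : C = crtCode C₂ Cw) (hcyc : IsCyclicCode C)
    (k₁ k₂ k₃ k₄ k₅ : ℕ) (htype : HasType C k₁ k₂ k₃ k₄ k₅)
    (h₂ : dualCode C₂ ≤ C₂) (hw : dualCode Cw ≤ Cw) :
    dualCode C ≤ C ∧
    ∃ K : ℕ, (K : ℤ) = 6 * k₁ + 4 * (k₂ + k₃) + 2 * (k₄ + k₅) - 3 * n ∧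
      (dualCode (grayCode C) ≤ grayCode C ∧
        IsQuantumCode (cssCode (grayCode C) (dualCode (grayCode C))) K (minLeeDist C)) ∧
      ∃ Q : Submodule ℂ (Qubits (Fin (3 * n))), IsExactQuantumCode Q K (minLeeDist C) := by
  obtain ⟨hdual, K, hK, hcss, hexact⟩ := theorem10_general hC htype h₂ hw
  exact ⟨hdual, K, hK, hcss, hexact (by obtain ⟨m, rfl⟩ := hn; omega)⟩
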